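/- **Setting.** Let $\mathbf F_i(x)=\tfrac12(x+p_i)$ on $\mathbb R^2$, where $p_1=(0,0)$, $p_2=(1,0)$, $p_3=(1/2,\sqrt3/2)$; put $V_0=\{p_1,p_2,p_3\}$, $V_{m+1}=\bigcup_{i}\mathbf F_i(V_m)$ and $\hat V_m=\bigcup_{k\ge0}2^k\,[V_{m+k}\cup(-V_{m+k})]$ for $m\ge 0$. The compact gasket is $\mathbb S=\overline{\bigcup_m V_m}$ and the infinite gasket is $\hat{\mathbb S}=\overline{\bigcup_m\hat V_m}$. Then $\hat{\mathbb S}$ is the union, with overlaps only at vertices, of triangles $\tau_i(\mathbb S)$, $i\in\mathbb Z$, where the isometries $\tau_i$ run through the maps $x\mapsto x+v$ and $x\mapsto-(x+v)$ with $v$ in $\{2^k\mathbf F_{w_1}\cdots\mathbf F_{w_k}(0):k\ge0,\ w_1,\dots,w_k\in\{1,2,3\}\}$. The *dyadic triangles* are the sets $2^m\tau_i(\mathbb S)$, $m,i\in\mathbb Z$. Let $\nu$ be the Borel probability measure on $\mathbb S$ with $\nu(\mathbf F_{w_1}\cdots\mathbf F_{w_m}(\mathbb S))=3^{-m}$ for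 all $m$ and $w_1,\dots,w_m\in\{1,2,3\}$, and let $\hat\nu=\sum_i(\tau_i)_*\nu$ be the Hausdorff measure on $\hat{\mathbb S}$. For $u:\hat{\mathbb S}\to\mathbb R$ let $$\hat{\mathcal E}(u)=\lim_{m\to\infty}\ \sum_{x\sim_m y}\tfrac12\,(5/3)^m\,[u(x)-u(y)]^2\in[0,\infty],$$ where the sum is over the ordered pairs $(x,y)$ of distinct vertices of a common dyadic triangle of side length $2^{-m}$ (the sums are non-decreasing in $m$). Let $\mathcal F(\hat{\mathbb S})$ be the space of continuous $u:\hat{\mathbb S}\to\mathbb R$ with $\hat{\mathcal E}(u)<\infty$ and $u\in L^2(\hat\nu)$. **Theorem.** Let $\hat\sigma$ be a Borel measure on $\hat{\mathbb S}$. Suppose that there are constants $p,q\in(0,\infty)$, $N\ge1$, $b_1,\dots,b_N\in[0,1]$ and $C>0$ such that $$\|u\|_{L^q(\hat\sigma)}\le C\sum_{i=1}^N\hat{\mathcal E}(u)^{b_i/2}\,\|u\|_{L^p(\hat\nu)}^{1-b_i}\qquad\text{for all }u\in\mathcal F(\hat{\mathbb S}).$$ Then there are exponents $0<\underline\delta\le\bar\delta\le\infty$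 with $\bar\delta\ge1$ and a constant $C_{\hat\sigma}\ge1$ such that, for every dyadic triangle $S\subseteq\hat{\mathbb S}$, $$\hat\sigma(S)\le C_{\hat\sigma}\,\hat\nu(S)^{1/\bar\delta}\ \text{ if }0<\operatorname{diam}(S)<1,\qquad \hat\sigma(S)\le C_{\hat\sigma}\,\hat\nu(S)^{1/\underline\delta}\ \text{ if }\operatorname{diam}(S)\ge1,$$ where $1/\infty=0$ and $\operatorname{diam}$ is the Euclidean diameter. -/

import Mathlib

open MeasureTheory Set Filter Topology
open scoped ENNReal Pointwise

namespace SierpinskiGasket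

/-- The Euclidean plane. -/
abbrev Plane : Type := EuclideanSpace ℝ (Fin 2)

/-- The three points `(0,0)`, `(1,0)`, `(1/2, √3/2)`. -/
noncomputable def corner : Fin 3 → Plane :=
  ![!₂[0, 0], !₂[1, 0], !₂[1 / 2, Real.sqrt 3 / 2]]

/-- The contractions `F i x = (x + corner i) / 2`. -/
noncomputable def F (i : Fin 3) (x : Plane) : Plane := (2 : ℝ)⁻¹ • (x + corner i)

/-- `FWord [i₁, …, iₘ] = F i₁ ∘ ⋯ ∘ F iₘ`, the identity for the empty word. -/
noncomputable def FWord : List (Fin 3) → Plane → Plane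
  | [] => id
  | i :: w => F i ∘ FWord w

/-- The vertex sets `V₀ = {corners}`, `Vₘ₊₁ = ⋃ i, F i (Vₘ)`. -/
noncomputable def V : ℕ → Set Plane
  | 0 => range corner
  | m + 1 => ⋃ i : Fin 3, F i '' V m

/-- The vertex sets `⋃ k, 2ᵏ (Vₘ₊ₖ ∪ -Vₘ₊ₖ)` of the infinite gasket. -/
noncomputable def VHat (m : ℕ) : Set Plane :=
  ⋃ k : ℕ, ((2 : ℝ) ^ k) • (V (m + k) ∪ -V (m + k))

/-- The compact Sierpinski gasket. -/
noncomputable def gasket : Set Plane := closure (⋃ m : ℕ, V m)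

/-- The infinite Sierpinski gasket. -/
noncomputable def infGasket : Set Plane := closure (⋃ m : ℕ, VHat m)

/-- The lower left corners `2ᵏ F_w (0)`, `w` a word of length `k`, of the triangles of side length
`1` in the upper half `⋃ k, 2ᵏ • gasket` of the infinite gasket. -/
noncomputable def unitCorners : Set Plane :=
  {v | ∃ w : List (Fin 3), v = ((2 : ℝ) ^ w.length) • FWord w 0}

/-- Labels of the triangles of side length `1` that make up the infinite gasket: an orientation
(`true` in the upper half, `false` in the lower half) and a position. Distinct labels belong to
distinct triangles. -/
abbrev Label : Type := Bool × unitCorners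

/-- The isometries `x ↦ x + v` and `x ↦ -(x + v)` that carry the compact gasket onto the
triangles of side length `1` in the infinite gasket. -/
noncomputable def τ (i : Label) (x : Plane) : Plane :=
  if i.1 then x + (i.2 : Plane) else -(x + (i.2 : Plane))

/-- The dyadic triangle `2ᵐ τᵢ(gasket)`, of side length `2ᵐ`. -/
noncomputable def triangle (i : Label) (m : ℤ) : Set Plane :=
  ((2 : ℝ) ^ m) • (τ i '' gasket)

/-- The three vertices `2ᵐ τᵢ(V₀)` of `triangle i m`. -/
noncomputable def triangleVertices (i : Label) (m : ℤ) : Set Plane :=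
  ((2 : ℝ) ^ m) • (τ i '' V 0)

/-- Dyadic triangles, as subsets of the infinite gasket. -/
def IsDyadicTriangle (S : Set infGasket) : Prop :=
  ∃ (i : Label) (m : ℤ), S = Subtype.val ⁻¹' triangle i m

/-! ### The Hausdorff measure -/

/-- The point `∑ₙ 2⁻⁽ⁿ⁺¹⁾ corner (ω n)` of the gasket with address `ω`, that is
`lim F (ω 0) ∘ ⋯ ∘ F (ω n) (0)`. -/
noncomputable def address (ω : ℕ → Fin 3) : Plane :=
  ∑' n : ℕ, ((2 : ℝ)⁻¹ ^ (n + 1)) • corner (ω n)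

/-- The normalised Hausdorff measure of the compact gasket, as a measure on the plane: the law of
the point whose address is a sequence of independent uniformly distributed symbols. It is the
Borel probability measure that gives mass `3⁻ᵐ` to each `FWord w '' gasket` with
`w.length = m`. -/
noncomputable def gasketMeasure : Measure Plane :=
  (Measure.infinitePi fun _ : ℕ => (PMF.uniformOfFintype (Fin 3)).toMeasure).map address

/-- The Hausdorff measure of the infinite gasket: a copy of `gasketMeasure` on each triangle of
side length `1`. -/
noncomputable def νHat : Measure infGasket :=
  (Measure.sum fun i : Label => gasketMeasure.map (τ i)).comap Subtype.val

/-! ### The standard Dirichlet form -/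

/-- Neighbours in the vertex set `VHat m`: vertices at distance `2⁻ᵐ` that belong to the same
dyadic triangle of side length `2⁻ᵐ`. -/
def Adj (m : ℕ) (x y : Plane) : Prop :=
  x ∈ VHat m ∧ y ∈ VHat m ∧ dist x y = (2 : ℝ)⁻¹ ^ m ∧
    ∃ i : Label, x ∈ triangleVertices i (-m) ∧ y ∈ triangleVertices i (-m)

/-- The discrete energy of level `m`, a sum over ordered pairs of neighbours. -/
noncomputable def discreteEnergy (m : ℕ) (u : infGasket → ℝ) : ℝ≥0∞ :=
  ∑' e : {e : infGasket × infGasket // Adj m e.1 e.2},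
    ENNReal.ofReal (2⁻¹ * (5 / 3) ^ m * (u e.1.1 - u e.1.2) ^ 2)

/-- The energy `lim discreteEnergy m u`; the sequence is non-decreasing in `m`. -/
noncomputable def energy (u : infGasket → ℝ) : ℝ≥0∞ :=
  liminf (fun m : ℕ => discreteEnergy m u) atTop

/-- The domain of the Dirichlet form on `L²(νHat)`: the continuous functions for which
`energy u ^ (1/2) + ‖u‖_{L²(νHat)}` is finite. -/
def dirichletDomain : Set C(infGasket, ℝ) :=
  {u | energy u < ∞ ∧ MemLp u 2 νHat}

/-! ### Sobolev inequalities and upper regularity -/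

/-- The inequality
`‖u‖_{L^q(σ)} ≤ C ∑ᵢ energy(u)^{bᵢ/2} ‖u‖_{L^p(νHat)}^{1 - bᵢ}` for all `u` in the domain. -/
def SobolevInequality (σ : Measure infGasket) (p q : ℝ) {N : ℕ} (b : Fin N → ℝ) (C : ℝ) : Prop :=
  ∀ u ∈ dirichletDomain,
    eLpNorm u (ENNReal.ofReal q) σ ≤
      ENNReal.ofReal C *
        ∑ i, energy u ^ (b i / 2) * eLpNorm u (ENNReal.ofReal p) νHat ^ (1 - b i)

/-- The two-scale upper regularity condition on `σ`, with constant `C` and exponents `δlo` (for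
triangles of diameter at least `1`) and `δhi` (for triangles of diameter less than `1`), where
`1 / ∞ = 0`. -/
def UpperRegular (σ : Measure infGasket) (C : ℝ) (δlo δhi : ℝ≥0∞) : Prop :=
  ∀ S : Set infGasket, IsDyadicTriangle S →
    (0 < Metric.diam S → Metric.diam S < 1 →
      σ S ≤ ENNReal.ofReal C * νHat S ^ (1 / δhi).toReal) ∧
    (1 ≤ Metric.diam S →
      σ S ≤ ENNReal.ofReal C * νHat S ^ (1 / δlo).toReal)

end SierpinskiGasket

namespace SierpinskiGasket

/-! The exponents may be chosen freely, and the extreme choice `δlo = 1`, `δhi = ∞` suffices: small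
triangles then need only a uniform bound on `σ`, and large ones a bound linear in `νHat`. Both
follow from one constant bounding `σ` on all unit triangles
(`SobolevInequality.exists_measure_tile_le`). A small triangle lies in a unit one
(`exists_triangle_subset_tile`). A large one is covered by the unit triangles it contains, each of
which contributes mass 1 to its `νHat` measure (`measure_triangle_le`).

The unit bound comes from testing the inequality on `bump i`, which is 1 on `tile i`, harmonic on
each tile, and zero on every tile not sharing a corner with `tile i`. At most 18 tiles share one, so
its energy and its `L^p` norm are bounded independently of `i`, and Chebyshev's inequality bounds
`σ` on the tile.

Most of the work is to construct `bump i`. A harmonic function is built on symbol sequences by the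
1/5-2/5 rule. It descends to the gasket because distinct addresses of one point first separate at a
midpoint shared by two cells (`harmonic_eq_of_address_eq`), and it glues across tiles because these
meet at corners only (`mem_range_corner_of_τ_eq`). Its energy does not grow with the level because
one subdivision multiplies the unscaled energy by exactly 3/5 (`sum_cornerEnergy_harmonicStep`). -/

/-! ### Barycentric coordinates -/

/-- The second and third barycentric coordinates with respect to the corners. -/
noncomputable def coord (x : Plane) : ℝ × ℝ :=
  (x 0 - x 1 / Real.sqrt 3, 2 * x 1 / Real.sqrt 3)

lemma coord_add (x y : Plane) : coord (x + y) = coord x + coord y := by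
  ext <;> simp [coord] <;> ring

lemma coord_smul (c : ℝ) (x : Plane) : coord (c • x) = c • coord x := by
  ext <;> simp [coord] <;> ring

lemma coord_neg (x : Plane) : coord (-x) = -coord x := by
  ext <;> simp [coord] <;> ring

lemma coord_injective : Function.Injective coord := by
  intro x y h
  have h3 : Real.sqrt 3 ≠ 0 := by positivity
  simp only [coord, Prod.mk.injEq] at h
  obtain ⟨h1, h2⟩ := h
  have e1 : x 1 = y 1 := by
    field_simp at h2
    linarith
  rw [e1] at h1
  ext i
  fin_cases i
  · simpa using h1
  · exact e1

lemma continuous_coord : Continuous coord := by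
  unfold coord
  fun_prop

@[simp] lemma coord_zero : coord 0 = 0 := by
  ext <;> simp [coord]

lemma corner_zero : corner 0 = 0 := by
  ext i
  fin_cases i <;> simp [corner]

lemma coord_corner_zero : coord (corner 0) = (0, 0) := by
  simp [coord, corner]

lemma coord_corner_one : coord (corner 1) = (1, 0) := by
  simp [coord, corner]

lemma coord_corner_two : coord (corner 2) = (0, 1) := by
  have h3 : Real.sqrt 3 ≠ 0 := by positivity
  simp only [coord, corner]
  ext
  · simp
    field_simp
    norm_num
  · simp
    field_simp

lemma dist_corner_zero_one : dist (corner 0) (corner 1) = 1 := by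
  simp [EuclideanSpace.dist_eq, corner]

lemma dist_corner_le (i j : Fin 3) : dist (corner i) (corner j) ≤ 1 := by
  rw [EuclideanSpace.dist_eq, Real.sqrt_le_one]
  have h3 : Real.sqrt 3 ^ 2 = 3 := Real.sq_sqrt (by norm_num)
  fin_cases i <;> fin_cases j <;>
    simp [corner, Real.dist_eq, sq_abs, div_pow, h3] <;> norm_num [div_pow, h3]

/-- The closed triangle spanned by the corners, in barycentric coordinates. -/
def solidTriangle : Set Plane :=
  {x | 0 ≤ (coord x).1 ∧ 0 ≤ (coord x).2 ∧ (coord x).1 + (coord x).2 ≤ 1}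

lemma isClosed_solidTriangle : IsClosed solidTriangle := by
  have := continuous_coord
  exact (isClosed_le continuous_const this.fst).inter
    ((isClosed_le continuous_const this.snd).inter
      (isClosed_le (this.fst.add this.snd) continuous_const))

lemma corner_mem_solidTriangle (i : Fin 3) : corner i ∈ solidTriangle := by
  fin_cases i
  · simp [solidTriangle, coord_corner_zero]
  · simp [solidTriangle, coord_corner_one]
  · simp [solidTriangle, coord_corner_two]

lemma F_mem_solidTriangle {x : Plane} (hx : x ∈ solidTriangle) (i : Fin 3) :
    F i x ∈ solidTriangle := by
  have hi := corner_mem_solidTriangle i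
  simp only [solidTriangle, mem_ofPred_eq, F, coord_smul, coord_add, Prod.smul_fst, Prod.smul_snd,
    Prod.fst_add, Prod.snd_add, smul_eq_mul] at *
  refine ⟨?_, ?_, ?_⟩ <;> linarith [hx.1, hx.2.1, hx.2.2, hi.1, hi.2.1, hi.2.2]

lemma gasket_subset_solidTriangle : gasket ⊆ solidTriangle := by
  refine closure_minimal (iUnion_subset fun m => ?_) isClosed_solidTriangle
  induction m with
  | zero => rintro _ ⟨i, rfl⟩; exact corner_mem_solidTriangle i
  | succ m ih =>
    refine iUnion_subset fun i => ?_
    rintro _ ⟨x, hx, rfl⟩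
    exact F_mem_solidTriangle (ih hx) i

/-- Two points of the solid triangle that differ by a nonzero lattice vector are corners. -/
lemma mem_range_corner_of_add_lattice {x y : Plane} (hx : x ∈ solidTriangle)
    (hy : y ∈ solidTriangle) {a b : ℤ} (hab : (a, b) ≠ 0)
    (h : coord y = coord x + ((a : ℝ), (b : ℝ))) : x ∈ range corner := by
  obtain ⟨hx1, hx2, hx3⟩ := hx
  obtain ⟨hy1, hy2, hy3⟩ := hy
  have h1 : (coord y).1 = (coord x).1 + a := by rw [h]; rfl
  have h2 : (coord y).2 = (coord x).2 + b := by rw [h]; rfl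
  -- The three barycentric coordinates change by `a`, `b`, `-(a + b)`. These sum to zero and do not
  -- all vanish, so some coordinate drops by at least 1 and must equal 1 at `x`.
  have key : a ≤ -1 ∨ b ≤ -1 ∨ 1 ≤ a + b := by
    by_contra hc
    push Not at hc
    apply hab
    have : a = 0 := by omega
    have : b = 0 := by omega
    simp [*]
  rcases key with k | k | k
  · have k' : (a : ℝ) ≤ -1 := by exact_mod_cast k
    exact ⟨1, coord_injective (by rw [coord_corner_one]; ext <;> simp <;> linarith)⟩
  · have k' : (b : ℝ) ≤ -1 := by exact_mod_cast k
    exact ⟨2, coord_injective (by rw [coord_corner_two]; ext <;> simp <;> linarith)⟩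
  · have k' : (1 : ℝ) ≤ a + b := by exact_mod_cast k
    exact ⟨0, coord_injective (by rw [coord_corner_zero]; ext <;> simp <;> linarith)⟩

/-- The barycentric coordinate of `x` belonging to `corner j` exceeds that of `y` by 1, so it equals
1. After halving, this says that two first-level cells meet only at a midpoint. -/
lemma eq_corner_of_add_corner {x y : Plane} (hx : x ∈ solidTriangle) (hy : y ∈ solidTriangle)
    {i j : Fin 3} (hij : i ≠ j) (h : x + corner i = y + corner j) : x = corner j := by
  obtain ⟨hx1, hx2, hx3⟩ := hx
  obtain ⟨hy1, hy2, hy3⟩ := hy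
  have h' : coord x + coord (corner i) = coord y + coord (corner j) := by
    rw [← coord_add, ← coord_add, h]
  have h1 := congrArg Prod.fst h'
  have h2 := congrArg Prod.snd h'
  simp only [Prod.fst_add, Prod.snd_add] at h1 h2
  apply coord_injective
  fin_cases i <;> fin_cases j <;>
    simp only [Fin.zero_eta, Fin.mk_one, Fin.reduceFinMk, ne_eq, not_true_eq_false,
      coord_corner_zero, coord_corner_one, coord_corner_two] at * <;>
    ext <;> simp only <;> linarith

/-! ### Addresses -/

/-- The address whose first symbol is `i` and whose tail is `ω`. -/
def cons (i : Fin 3) (ω : ℕ → Fin 3) : ℕ → Fin 3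
  | 0 => i
  | n + 1 => ω n

/-- The address without its first symbol. -/
def tail (ω : ℕ → Fin 3) : ℕ → Fin 3 := fun n => ω (n + 1)

lemma cons_tail (ω : ℕ → Fin 3) : cons (ω 0) (tail ω) = ω := by
  funext n
  cases n <;> rfl

lemma summable_pow_half_succ : Summable fun n : ℕ => ((2 : ℝ)⁻¹ ^ (n + 1)) := by
  simp_rw [pow_succ]
  exact (summable_geometric_of_lt_one (by norm_num) (by norm_num)).mul_right _

lemma tsum_pow_half_succ : ∑' n : ℕ, ((2 : ℝ)⁻¹ ^ (n + 1)) = 1 := by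
  simp_rw [pow_succ]
  rw [tsum_mul_right, tsum_geometric_of_lt_one (by norm_num) (by norm_num)]
  norm_num

lemma norm_corner_le (i : Fin 3) : ‖corner i‖ ≤ 1 := by
  have := dist_corner_le i 0
  rwa [corner_zero, dist_zero_right] at this

lemma norm_address_term_le (ω : ℕ → Fin 3) (n : ℕ) :
    ‖((2 : ℝ)⁻¹ ^ (n + 1)) • corner (ω n)‖ ≤ (2 : ℝ)⁻¹ ^ (n + 1) := by
  rw [norm_smul, norm_pow, norm_inv, Real.norm_ofNat]
  exact mul_le_of_le_one_right (by positivity) (norm_corner_le _)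

lemma summable_address (ω : ℕ → Fin 3) :
    Summable fun n : ℕ => ((2 : ℝ)⁻¹ ^ (n + 1)) • corner (ω n) :=
  Summable.of_norm_bounded summable_pow_half_succ (norm_address_term_le ω)

lemma continuous_address : Continuous address := by
  refine continuous_tsum (fun n => ?_) summable_pow_half_succ (fun n ω => norm_address_term_le ω n)
  have h : Continuous fun ω : ℕ → Fin 3 => corner (ω n) :=
    (continuous_of_discreteTopology (f := corner)).comp (continuous_apply n)
  exact h.const_smul ((2 : ℝ)⁻¹ ^ (n + 1))

lemma address_cons (i : Fin 3) (ω : ℕ → Fin 3) : address (cons i ω) = F i (address ω) := by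
  rw [address, (summable_address _).tsum_eq_zero_add, F, smul_add, address, ← tsum_const_smul'',
    add_comm]
  simp only [cons, zero_add, smul_smul, pow_succ', pow_zero, mul_one]

lemma address_eq (ω : ℕ → Fin 3) : address ω = F (ω 0) (address (tail ω)) := by
  rw [← address_cons, cons_tail]

lemma address_const (i : Fin 3) : address (fun _ => i) = corner i := by
  rw [address, summable_pow_half_succ.tsum_smul_const, tsum_pow_half_succ, one_smul]

lemma dist_address_le (ω η : ℕ → Fin 3) : dist (address ω) (address η) ≤ 1 := by
  rw [dist_eq_norm, address, address, ← (summable_address ω).tsum_sub (summable_address η),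
    ← tsum_pow_half_succ]
  refine tsum_of_norm_bounded summable_pow_half_succ.hasSum fun n => ?_
  rw [← smul_sub, norm_smul, norm_pow, norm_inv, Real.norm_ofNat, ← dist_eq_norm]
  exact mul_le_of_le_one_right (by positivity) (dist_corner_le _ _)

lemma dist_F (i : Fin 3) (x y : Plane) : dist (F i x) (F i y) = 2⁻¹ * dist x y := by
  rw [F, F, dist_smul₀, dist_add_right]
  simp

lemma V_subset_range_address (m : ℕ) : V m ⊆ range address := by
  induction m with
  | zero => rintro _ ⟨i, rfl⟩; exact ⟨_, address_const i⟩
  | succ m ih =>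
    refine iUnion_subset fun i => ?_
    rintro _ ⟨x, hx, rfl⟩
    obtain ⟨ω, rfl⟩ := ih hx
    exact ⟨_, address_cons i ω⟩

lemma exists_mem_V_dist_address_le (m : ℕ) (ω : ℕ → Fin 3) :
    ∃ x ∈ V m, dist x (address ω) ≤ (2 : ℝ)⁻¹ ^ m := by
  induction m generalizing ω with
  | zero =>
    refine ⟨corner 0, mem_range_self _, ?_⟩
    rw [← address_const, pow_zero]
    exact dist_address_le _ _
  | succ m ih =>
    obtain ⟨x, hx, hd⟩ := ih (tail ω)
    refine ⟨F (ω 0) x, mem_iUnion.2 ⟨_, x, hx, rfl⟩, ?_⟩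
    rw [address_eq, dist_F, pow_succ']
    gcongr

/-- The range is compact and contains every vertex; conversely, vertices of level `m` approximate
each address to within `2⁻ᵐ`. Later arguments can thus work with symbol sequences. -/
lemma gasket_eq_range_address : gasket = range address := by
  apply Subset.antisymm
  · exact closure_minimal (iUnion_subset V_subset_range_address)
      (isCompact_range continuous_address).isClosed
  · rintro _ ⟨ω, rfl⟩
    refine Metric.mem_closure_iff.2 fun ε hε => ?_
    obtain ⟨m, hm⟩ := exists_pow_lt_of_lt_one hε (show (2 : ℝ)⁻¹ < 1 by norm_num)
    obtain ⟨x, hx, hd⟩ := exists_mem_V_dist_address_le m ω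
    exact ⟨x, mem_iUnion.2 ⟨m, hx⟩, by rw [dist_comm]; exact hd.trans_lt hm⟩

lemma address_mem_gasket (ω : ℕ → Fin 3) : address ω ∈ gasket :=
  gasket_eq_range_address ▸ mem_range_self ω

lemma address_mem_solidTriangle (ω : ℕ → Fin 3) : address ω ∈ solidTriangle :=
  gasket_subset_solidTriangle (address_mem_gasket ω)

lemma corner_mem_gasket (i : Fin 3) : corner i ∈ gasket :=
  address_const i ▸ address_mem_gasket _

lemma isCompact_gasket : IsCompact gasket :=
  gasket_eq_range_address ▸ isCompact_range continuous_address

lemma F_mem_gasket {x : Plane} (hx : x ∈ gasket) (i : Fin 3) : F i x ∈ gasket := by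
  rw [gasket_eq_range_address] at *
  obtain ⟨ω, rfl⟩ := hx
  exact ⟨_, address_cons i ω⟩

lemma exists_eq_F_of_mem_gasket {x : Plane} (hx : x ∈ gasket) :
    ∃ i, ∃ y ∈ gasket, x = F i y := by
  rw [gasket_eq_range_address] at hx
  obtain ⟨ω, rfl⟩ := hx
  exact ⟨ω 0, _, address_mem_gasket (tail ω), address_eq ω⟩

lemma diam_gasket : Metric.diam gasket = 1 := by
  apply le_antisymm
  · refine Metric.diam_le_of_forall_dist_le zero_le_one ?_
    rw [gasket_eq_range_address]
    rintro _ ⟨ω, rfl⟩ _ ⟨η, rfl⟩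
    exact dist_address_le ω η
  · rw [← dist_corner_zero_one]
    exact Metric.dist_le_diam_of_mem isCompact_gasket.isBounded (corner_mem_gasket 0)
      (corner_mem_gasket 1)

/-- Addresses with different first symbols of a common point. -/
lemma address_tail_eq_corner {ω η : ℕ → Fin 3} (h : address ω = address η) (h0 : ω 0 ≠ η 0) :
    address (tail ω) = corner (η 0) := by
  rw [address_eq ω, address_eq η, F, F] at h
  exact eq_corner_of_add_corner (address_mem_solidTriangle _) (address_mem_solidTriangle _) h0
    (smul_right_injective Plane (show (2 : ℝ)⁻¹ ≠ 0 by norm_num) h)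

lemma corner_injective : Function.Injective corner := by
  intro i j h
  have h' := congrArg coord h
  fin_cases i <;> fin_cases j <;>
    simp [coord_corner_zero, coord_corner_one, coord_corner_two] at h' ⊢

/-- A corner has only one address. -/
lemma eq_const_of_address_eq_corner {ω : ℕ → Fin 3} {i : Fin 3} (h : address ω = corner i) :
    ω = fun _ => i := by
  have step : ∀ η : ℕ → Fin 3, address η = corner i → η 0 = i ∧ address (tail η) = corner i := by
    intro η hη
    rw [← address_const i] at hη
    have h0 : η 0 = i := by
      by_contra hne
      have := address_tail_eq_corner (η := η) hη.symm (Ne.symm hne)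
      rw [show tail (fun _ => i) = fun _ => i from rfl, address_const] at this
      exact hne (corner_injective this).symm
    refine ⟨h0, ?_⟩
    rw [address_eq η, address_eq (fun _ => i), F, F, h0] at hη
    have := add_right_cancel (smul_right_injective Plane (show (2 : ℝ)⁻¹ ≠ 0 by norm_num) hη)
    rw [this]
    exact address_const i
  funext n
  induction n generalizing ω with
  | zero => exact (step ω h).1
  | succ n ih => exact ih (step ω h).2

/-! ### Words -/

lemma FWord_append (w w' : List (Fin 3)) (x : Plane) :
    FWord (w ++ w') x = FWord w (FWord w' x) := by
  induction w with
  | nil => rfl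
  | cons i w ih => simp [FWord, ih]

lemma FWord_address (w : List (Fin 3)) (ω : ℕ → Fin 3) :
    FWord w (address ω) = address (w.foldr cons ω) := by
  induction w with
  | nil => rfl
  | cons i w ih => simp [FWord, ih, address_cons]

/-- The linear part of `FWord w` is the homothety of ratio `2⁻ᵏ`, with `k` the length of `w`, so
rescaling leaves a translation. -/
lemma two_pow_smul_FWord (w : List (Fin 3)) (x : Plane) :
    ((2 : ℝ) ^ w.length) • FWord w x = x + ((2 : ℝ) ^ w.length) • FWord w 0 := by
  induction w with
  | nil => simp [FWord]
  | cons i w ih =>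
    have h : ∀ y, ((2 : ℝ) ^ (w.length + 1)) • (F i y) = (2 : ℝ) ^ w.length • (y + corner i) := by
      intro y
      rw [F, smul_smul, pow_succ]
      congr 1
      ring
    simp only [FWord, List.length_cons, Function.comp, h, smul_add, ih]
    abel

lemma FWord_mem_V (w : List (Fin 3)) {x : Plane} {m : ℕ} (hx : x ∈ V m) :
    FWord w x ∈ V (m + w.length) := by
  induction w with
  | nil => exact hx
  | cons i w ih => exact mem_iUnion.2 ⟨i, _, ih, rfl⟩

/-- The last symbol is the lowest binary digit: appending it doubles the position and adds a corner.
Inductions on `unitCorners` rest on this recursion. -/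
lemma two_pow_smul_FWord_concat (w : List (Fin 3)) (i : Fin 3) :
    ((2 : ℝ) ^ (w ++ [i]).length) • FWord (w ++ [i]) 0 =
      (2 : ℝ) • ((2 : ℝ) ^ w.length) • FWord w 0 + corner i := by
  rw [FWord_append, List.length_append, pow_add, mul_comm, mul_smul, two_pow_smul_FWord]
  simp [FWord, F, smul_smul, add_comm]

/-! ### Corners of the unit triangles -/

lemma zero_mem_unitCorners : (0 : Plane) ∈ unitCorners :=
  ⟨[], by simp [FWord]⟩

lemma two_smul_add_corner_mem_unitCorners {v : Plane} (hv : v ∈ unitCorners) (i : Fin 3) :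
    (2 : ℝ) • v + corner i ∈ unitCorners := by
  obtain ⟨w, rfl⟩ := hv
  exact ⟨w ++ [i], (two_pow_smul_FWord_concat w i).symm⟩

lemma exists_eq_two_smul_add_corner {v : Plane} (hv : v ∈ unitCorners) :
    ∃ v' ∈ unitCorners, ∃ i, v = (2 : ℝ) • v' + corner i := by
  obtain ⟨w, rfl⟩ := hv
  rcases List.eq_nil_or_concat' w with rfl | ⟨w, i, rfl⟩
  · exact ⟨0, zero_mem_unitCorners, 0, by simp [FWord, corner_zero]⟩
  · exact ⟨_, ⟨w, rfl⟩, i, two_pow_smul_FWord_concat w i⟩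

lemma exists_nat_coord_of_mem_unitCorners {v : Plane} (hv : v ∈ unitCorners) :
    ∃ a b : ℕ, coord v = ((a : ℝ), (b : ℝ)) := by
  obtain ⟨w, rfl⟩ := hv
  induction w using List.reverseRecOn with
  | nil => exact ⟨0, 0, by simp [FWord, Prod.zero_eq_mk]⟩
  | append_singleton w i ih =>
    obtain ⟨a, b, h⟩ := ih
    rw [two_pow_smul_FWord_concat, coord_add, coord_smul, h]
    fin_cases i
    · exact ⟨2 * a, 2 * b, by simp [coord_corner_zero]⟩
    · exact ⟨2 * a + 1, 2 * b, by simp [coord_corner_one]⟩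
    · exact ⟨2 * a, 2 * b + 1, by simp [coord_corner_two]⟩

/-- A triangle of side length `2⁻ᵐ` is the image under a word of length `m` of a unit triangle. -/
lemma exists_inv_two_pow_smul_add {v : Plane} (hv : v ∈ unitCorners) (m : ℕ) :
    ∃ v' ∈ unitCorners, ∃ w : Fin m → Fin 3,
      ∀ x, ((2 : ℝ) ^ m)⁻¹ • (x + v) = FWord (List.ofFn w) x + v' := by
  induction m generalizing v with
  | zero => exact ⟨v, hv, Fin.elim0, by simp [FWord]⟩
  | succ m ih =>
    obtain ⟨v₁, hv₁, i, rfl⟩ := exists_eq_two_smul_add_corner hv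
    obtain ⟨v₂, hv₂, w, hw⟩ := ih hv₁
    refine ⟨v₂, hv₂, Fin.snoc w i, fun x => ?_⟩
    have e : (x + ((2 : ℝ) • v₁ + corner i)) = (2 : ℝ) • (F i x + v₁) := by
      rw [F, smul_add, smul_smul]
      norm_num
      abel
    rw [e, pow_succ, mul_inv, mul_smul, smul_smul (2⁻¹ : ℝ), inv_mul_cancel₀ two_ne_zero, one_smul, hw]
    rw [List.ofFn_succ', List.concat_eq_append, FWord_append]
    simp [FWord]

/-- Every point of a triangle of side length `2ᵐ` lies in a unit triangle contained in it. -/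
lemma exists_two_pow_smul_add {v : Plane} (hv : v ∈ unitCorners) (m : ℕ) {x : Plane}
    (hx : x ∈ gasket) :
    ∃ v' ∈ unitCorners, (∃ y ∈ gasket, ((2 : ℝ) ^ m) • (x + v) = y + v') ∧
      ∀ y ∈ gasket, ∃ z ∈ gasket, y + v' = ((2 : ℝ) ^ m) • (z + v) := by
  induction m generalizing v x with
  | zero => exact ⟨v, hv, ⟨x, hx, by simp⟩, fun y hy => ⟨y, hy, by simp⟩⟩
  | succ m ih =>
    obtain ⟨i, y, hy, rfl⟩ := exists_eq_F_of_mem_gasket hx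
    have e : ∀ z : Plane, ((2 : ℝ) ^ (m + 1)) • (F i z + v) =
        (2 : ℝ) ^ m • (z + ((2 : ℝ) • v + corner i)) := by
      intro z
      rw [pow_succ, mul_smul, F, smul_add, smul_smul]
      norm_num
      abel_nf
    obtain ⟨v', hv', h1, h2⟩ := ih (two_smul_add_corner_mem_unitCorners hv i) hy
    refine ⟨v', hv', by rwa [e], fun t ht => ?_⟩
    obtain ⟨z, hz, h⟩ := h2 t ht
    exact ⟨F i z, F_mem_gasket hz i, by rw [e, h]⟩

/-! ### Harmonic functions on the compact gasket -/

/-- The corner values on the cell `F i '' gasket` of the harmonic function with corner values `a`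
(the `1/5`-`2/5` rule). -/
noncomputable def harmonicStep (i : Fin 3) (a : Fin 3 → ℝ) (j : Fin 3) : ℝ :=
  if j = i then a i else (a i + a j + (a 0 + a 1 + a 2)) / 5

lemma harmonicStep_self (i : Fin 3) (a : Fin 3 → ℝ) : harmonicStep i a i = a i := by
  simp [harmonicStep]

/-- Both sides are the value at the midpoint shared by cells `i` and `j`; this is the compatibility
that lets the rule define a function on the gasket. -/
lemma harmonicStep_symm (i j : Fin 3) (a : Fin 3 → ℝ) :
    harmonicStep i a j = harmonicStep j a i := by
  unfold harmonicStep
  by_cases h : j = i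
  · simp [h]
  · rw [if_neg h, if_neg (Ne.symm h), add_comm (a i)]

lemma harmonicStep_const (i : Fin 3) (c : ℝ) : harmonicStep i (fun _ => c) = fun _ => c := by
  funext j
  unfold harmonicStep
  split_ifs
  · rfl
  · ring

lemma harmonicStep_mem_Icc {a : Fin 3 → ℝ} {c d : ℝ} (ha : ∀ j, a j ∈ Icc c d) (i j : Fin 3) :
    harmonicStep i a j ∈ Icc c d := by
  unfold harmonicStep
  split_ifs
  · exact ha i
  · have h := fun k => (ha k).1
    have h' := fun k => (ha k).2
    constructor <;> linarith [h i, h j, h 0, h 1, h 2, h' i, h' j, h' 0, h' 1, h' 2]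

/-- A corner and a midpoint differ by a combination of old differences with weights 2/5 and 1/5, two
midpoints by a single one with weight 1/5. Corner values therefore converge geometrically along an
address. -/
lemma abs_harmonicStep_sub_le {a : Fin 3 → ℝ} {d : ℝ} (ha : ∀ j k, |a j - a k| ≤ d)
    (i j k : Fin 3) : |harmonicStep i a j - harmonicStep i a k| ≤ 3 / 5 * d := by
  have h := fun j k => (abs_le.1 (ha j k)).2
  have h01 := h 0 1
  have h02 := h 0 2
  have h10 := h 1 0
  have h12 := h 1 2
  have h20 := h 2 0
  have h21 := h 2 1
  rw [abs_le]
  constructor <;> fin_cases i <;> fin_cases j <;> fin_cases k <;> simp [harmonicStep] <;> linarith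

lemma abs_harmonicStep_sub_self_le {a : Fin 3 → ℝ} {d : ℝ} (ha : ∀ j k, |a j - a k| ≤ d)
    (i j : Fin 3) : |harmonicStep i a j - a j| ≤ d := by
  have h := fun j k => (abs_le.1 (ha j k)).2
  have h01 := h 0 1
  have h02 := h 0 2
  have h10 := h 1 0
  have h12 := h 1 2
  have h20 := h 2 0
  have h21 := h 2 1
  rw [abs_le]
  constructor <;> fin_cases i <;> fin_cases j <;> simp [harmonicStep] <;> linarith

/-- The energy of the corner values `a`. -/
noncomputable def cornerEnergy (a : Fin 3 → ℝ) : ℝ := ∑ j, ∑ k, 2⁻¹ * (a j - a k) ^ 2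

/-- The factor 3/5 is what the renormalisation `(5/3)^m` in `discreteEnergy` cancels. -/
lemma sum_cornerEnergy_harmonicStep (a : Fin 3 → ℝ) :
    ∑ i, cornerEnergy (harmonicStep i a) = 3 / 5 * cornerEnergy a := by
  simp [cornerEnergy, Fin.sum_univ_three, harmonicStep]
  ring

lemma sum_cornerEnergy_foldl (m : ℕ) (a : Fin 3 → ℝ) :
    ∑ w : Fin m → Fin 3, cornerEnergy ((List.ofFn w).foldl (fun b i => harmonicStep i b) a) =
      (3 / 5) ^ m * cornerEnergy a := by
  induction m generalizing a with
  | zero => simp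
  | succ m ih =>
    rw [← (Fin.consEquiv fun _ : Fin (m + 1) => Fin 3).sum_comp, Fintype.sum_prod_type]
    have e : ∀ i (w : Fin m → Fin 3), (Fin.consEquiv fun _ : Fin (m + 1) => Fin 3) (i, w) =
        Fin.cons i w := fun _ _ => rfl
    simp only [e, List.ofFn_cons, List.foldl_cons, ih]
    rw [← Finset.mul_sum, sum_cornerEnergy_harmonicStep]
    ring

/-- The corner values, on the cell of level `n` with address `ω`, of the harmonic function with
corner values `a`. -/
noncomputable def cellValues (a : Fin 3 → ℝ) (ω : ℕ → Fin 3) : ℕ → Fin 3 → ℝ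
  | 0 => a
  | n + 1 => harmonicStep (ω n) (cellValues a ω n)

/-- The harmonic function with corner values `a`, as a function of the address. -/
noncomputable def harmonic (a : Fin 3 → ℝ) (ω : ℕ → Fin 3) : ℝ :=
  a 0 + ∑' n, (cellValues a ω (n + 1) 0 - cellValues a ω n 0)

/-- A bound for the oscillation of the corner values `a`. -/
def osc (a : Fin 3 → ℝ) : ℝ := |a 0 - a 1| + |a 1 - a 2| + |a 0 - a 2|

lemma abs_sub_le_osc (a : Fin 3 → ℝ) (j k : Fin 3) : |a j - a k| ≤ osc a := by
  have h1 := abs_nonneg (a 0 - a 1)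
  have h2 := abs_nonneg (a 1 - a 2)
  have h3 := abs_nonneg (a 0 - a 2)
  unfold osc
  fin_cases j <;> fin_cases k <;> simp [abs_sub_comm (a 1) (a 0), abs_sub_comm (a 2)] <;> linarith

lemma abs_cellValues_sub_le (a : Fin 3 → ℝ) (ω : ℕ → Fin 3) (n : ℕ) (j k : Fin 3) :
    |cellValues a ω n j - cellValues a ω n k| ≤ (3 / 5) ^ n * osc a := by
  induction n generalizing j k with
  | zero => simpa [cellValues] using abs_sub_le_osc a j k
  | succ n ih =>
    rw [pow_succ', mul_assoc]
    exact abs_harmonicStep_sub_le ih _ j k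

lemma norm_cellValues_succ_sub_le (a : Fin 3 → ℝ) (n : ℕ) (ω : ℕ → Fin 3) :
    ‖cellValues a ω (n + 1) 0 - cellValues a ω n 0‖ ≤ (3 / 5) ^ n * osc a :=
  abs_harmonicStep_sub_self_le (abs_cellValues_sub_le a ω n) _ 0

lemma summable_pow_mul_osc (a : Fin 3 → ℝ) : Summable fun n : ℕ => (3 / 5 : ℝ) ^ n * osc a :=
  (summable_geometric_of_lt_one (by norm_num) (by norm_num)).mul_right _

lemma tendsto_cellValues (a : Fin 3 → ℝ) (ω : ℕ → Fin 3) (j : Fin 3) :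
    Tendsto (fun n => cellValues a ω n j) atTop (𝓝 (harmonic a ω)) := by
  have h0 : Tendsto (fun n => cellValues a ω n 0) atTop (𝓝 (harmonic a ω)) := by
    have hs : Summable fun n => cellValues a ω (n + 1) 0 - cellValues a ω n 0 :=
      Summable.of_norm_bounded (summable_pow_mul_osc a)
        fun n => norm_cellValues_succ_sub_le a n ω
    have h := (hs.hasSum.tendsto_sum_nat).const_add (a 0)
    simp only [Finset.sum_range_sub (fun n => cellValues a ω n 0)] at h
    simpa only [harmonic, cellValues, add_sub_cancel] using h
  have h1 : Tendsto (fun n => cellValues a ω n j - cellValues a ω n 0) atTop (𝓝 0) :=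
    squeeze_zero_norm (fun n => abs_cellValues_sub_le a ω n j 0)
      (summable_pow_mul_osc a).tendsto_atTop_zero
  simpa using h1.add h0

lemma continuous_cellValues (a : Fin 3 → ℝ) (n : ℕ) (j : Fin 3) :
    Continuous fun ω => cellValues a ω n j := by
  induction n generalizing j with
  | zero => exact continuous_const
  | succ n ih =>
    have h : ∀ i, Continuous fun ω => harmonicStep i (cellValues a ω n) j := by
      intro i
      unfold harmonicStep
      split_ifs
      · exact ih i
      · exact ((((ih i).add (ih j)).add (((ih 0).add (ih 1)).add (ih 2))).div_const 5)
    -- The cell chosen at step `n` depends on `ω n` alone, which is locally constant.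
    refine continuous_iff_continuousAt.2 fun ω => ?_
    refine ((h (ω n)).continuousAt (x := ω)).congr ?_
    have : ∀ᶠ η : ℕ → Fin 3 in 𝓝 ω, η n = ω n :=
      ((isOpen_discrete {ω n}).preimage
        (continuous_apply (A := fun _ : ℕ => Fin 3) n)).mem_nhds (mem_singleton _)
    filter_upwards [this] with η hη
    simp [cellValues, hη]

lemma continuous_harmonic (a : Fin 3 → ℝ) : Continuous (harmonic a) :=
  continuous_const.add <| continuous_tsum
    (fun n => (continuous_cellValues a (n + 1) 0).sub (continuous_cellValues a n 0))
    (summable_pow_mul_osc a) (fun n ω => norm_cellValues_succ_sub_le a n ω)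

lemma cellValues_cons (a : Fin 3 → ℝ) (i : Fin 3) (ω : ℕ → Fin 3) (n : ℕ) :
    cellValues a (cons i ω) (n + 1) = cellValues (harmonicStep i a) ω n := by
  induction n with
  | zero => rfl
  | succ n ih => rw [cellValues, ih, cellValues, cons]

lemma harmonic_cons (a : Fin 3 → ℝ) (i : Fin 3) (ω : ℕ → Fin 3) :
    harmonic a (cons i ω) = harmonic (harmonicStep i a) ω := by
  have h := (tendsto_add_atTop_iff_nat 1).2 (tendsto_cellValues a (cons i ω) 0)
  simp only [cellValues_cons] at h
  exact tendsto_nhds_unique h (tendsto_cellValues _ ω 0)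

lemma harmonic_foldr_cons (a : Fin 3 → ℝ) (w : List (Fin 3)) (ω : ℕ → Fin 3) :
    harmonic a (w.foldr cons ω) = harmonic (w.foldl (fun b i => harmonicStep i b) a) ω := by
  induction w generalizing a with
  | nil => rfl
  | cons i w ih => rw [List.foldr_cons, harmonic_cons, ih, List.foldl_cons]

lemma harmonic_const_address (a : Fin 3 → ℝ) (i : Fin 3) : harmonic a (fun _ => i) = a i := by
  have h : ∀ n, cellValues a (fun _ => i) n i = a i := by
    intro n
    induction n with
    | zero => rfl
    | succ n ih => rw [cellValues, harmonicStep_self, ih]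
  have := tendsto_cellValues a (fun _ => i) i
  simp only [h] at this
  exact tendsto_nhds_unique this tendsto_const_nhds

lemma harmonic_const (c : ℝ) (ω : ℕ → Fin 3) : harmonic (fun _ => c) ω = c := by
  have h : ∀ n, cellValues (fun _ => c) ω n = fun _ => c := by
    intro n
    induction n with
    | zero => rfl
    | succ n ih => rw [cellValues, ih, harmonicStep_const]
  have := tendsto_cellValues (fun _ => c) ω 0
  simp only [h] at this
  exact tendsto_nhds_unique this tendsto_const_nhds

lemma harmonic_mem_Icc {a : Fin 3 → ℝ} {c d : ℝ} (ha : ∀ j, a j ∈ Icc c d) (ω : ℕ → Fin 3) :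
    harmonic a ω ∈ Icc c d := by
  refine isClosed_Icc.mem_of_tendsto (tendsto_cellValues a ω 0) (Eventually.of_forall fun n => ?_)
  suffices ∀ j, cellValues a ω n j ∈ Icc c d from this 0
  induction n with
  | zero => exact ha
  | succ n ih => exact harmonicStep_mem_Icc ih _

/-- Addresses that differ at once can only meet at the midpoint of two cells, so each tail repeats
the first symbol of the other address and `harmonicStep_symm` applies. -/
lemma harmonic_eq_of_address_eq_of_ne {ω η : ℕ → Fin 3} (h : address ω = address η)
    (h0 : ω 0 ≠ η 0) (a : Fin 3 → ℝ) : harmonic a ω = harmonic a η := by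
  have h1 := eq_const_of_address_eq_corner (address_tail_eq_corner h h0)
  have h2 := eq_const_of_address_eq_corner (address_tail_eq_corner h.symm h0.symm)
  rw [← cons_tail ω, ← cons_tail η, harmonic_cons, harmonic_cons, h1, h2, harmonic_const_address,
    harmonic_const_address, harmonicStep_symm]

/-- A harmonic function is a function on the gasket. -/
lemma harmonic_eq_of_address_eq {ω η : ℕ → Fin 3} (h : address ω = address η)
    (a : Fin 3 → ℝ) : harmonic a ω = harmonic a η := by
  -- Induction on a position of disagreement: a common first symbol is cancelled and absorbed into
  -- the corner values.
  have key : ∀ n (ω η : ℕ → Fin 3) (a : Fin 3 → ℝ), address ω = address η → ω n ≠ η n →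
      harmonic a ω = harmonic a η := by
    intro n
    induction n with
    | zero => exact fun ω η a h h0 => harmonic_eq_of_address_eq_of_ne h h0 a
    | succ n ih =>
      intro ω η a h hn
      by_cases h0 : ω 0 = η 0
      · rw [← cons_tail ω, ← cons_tail η, harmonic_cons, harmonic_cons, h0]
        refine ih _ _ _ ?_ hn
        rw [address_eq ω, address_eq η, F, F, h0] at h
        exact add_right_cancel
          (smul_right_injective Plane (show (2 : ℝ)⁻¹ ≠ 0 by norm_num) h)
      · exact harmonic_eq_of_address_eq_of_ne h h0 a
  by_cases hne : ω = η
  · rw [hne]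
  · obtain ⟨n, hn⟩ := Function.ne_iff.1 hne
    exact key n ω η a h hn

/-! ### The unit triangles -/

/-- The triangle of side length `1` with label `i`. -/
noncomputable def tile (i : Label) : Set Plane := τ i '' gasket

lemma isometry_τ (i : Label) : Isometry (τ i) := by
  refine Isometry.of_dist_eq fun x y => ?_
  unfold τ
  split_ifs
  · exact dist_add_right _ _ _
  · rw [dist_neg_neg, dist_add_right]

lemma isCompact_tile (i : Label) : IsCompact (tile i) :=
  isCompact_gasket.image (isometry_τ i).continuous

lemma mem_tile_address (i : Label) (ω : ℕ → Fin 3) : τ i (address ω) ∈ tile i :=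
  mem_image_of_mem _ (address_mem_gasket ω)

lemma exists_address_of_mem_tile {i : Label} {x : Plane} (hx : x ∈ tile i) :
    ∃ ω, τ i (address ω) = x := by
  obtain ⟨y, hy, rfl⟩ := hx
  rw [gasket_eq_range_address] at hy
  obtain ⟨ω, rfl⟩ := hy
  exact ⟨ω, rfl⟩

instance : Countable unitCorners := by
  have : unitCorners = range fun w : List (Fin 3) => ((2 : ℝ) ^ w.length) • FWord w 0 := by
    ext v
    simp only [unitCorners, mem_ofPred_eq, mem_range, eq_comm]
  rw [this]
  exact (countable_range _).to_subtype

lemma finite_unitCorners_inter_preimage_Icc (r : ℝ) :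
    {v : unitCorners | (coord v).1 ≤ r ∧ (coord v).2 ≤ r}.Finite := by
  refine Finite.of_finite_image (f := fun v => coord (v : Plane)) ?_
    (coord_injective.comp Subtype.val_injective).injOn
  refine (((finite_Iic ⌊r⌋₊).prod (finite_Iic ⌊r⌋₊)).image
    fun z : ℕ × ℕ => ((z.1 : ℝ), (z.2 : ℝ))).subset ?_
  rintro _ ⟨v, ⟨h1, h2⟩, rfl⟩
  obtain ⟨a, b, h⟩ := exists_nat_coord_of_mem_unitCorners v.2
  rw [h] at h1 h2
  exact ⟨(a, b), ⟨Nat.le_floor h1, Nat.le_floor h2⟩, h.symm⟩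

lemma coord_le_of_mem_tile {i : Label} {x : Plane} (hx : x ∈ tile i) :
    (coord (i.2 : Plane)).1 ≤ |(coord x).1| ∧ (coord (i.2 : Plane)).2 ≤ |(coord x).2| := by
  obtain ⟨y, hy, rfl⟩ := hx
  obtain ⟨h1, h2, -⟩ := gasket_subset_solidTriangle hy
  unfold τ
  split_ifs
  · rw [coord_add, Prod.fst_add, Prod.snd_add]
    constructor <;> refine le_trans ?_ (le_abs_self _) <;> linarith
  · rw [coord_neg, coord_add, Prod.fst_neg, Prod.snd_neg, abs_neg, abs_neg, Prod.fst_add,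
      Prod.snd_add]
    constructor <;> refine le_trans ?_ (le_abs_self _) <;> linarith

lemma locallyFinite_tile : LocallyFinite tile := by
  intro x
  refine ⟨coord ⁻¹' ((fun z => (|z.1|, |z.2|)) ⁻¹'
    (Iio (|(coord x).1| + 1) ×ˢ Iio (|(coord x).2| + 1))), ?_, ?_⟩
  · refine IsOpen.mem_nhds ?_ (by simp)
    exact (isOpen_Iio.prod isOpen_Iio).preimage (by fun_prop) |>.preimage continuous_coord
  · set r := max (|(coord x).1| + 1) (|(coord x).2| + 1)
    refine ((finite_univ (α := Bool)).prod (finite_unitCorners_inter_preimage_Icc r)).subset ?_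
    rintro i ⟨y, hy, hy'⟩
    obtain ⟨h1, h2⟩ := coord_le_of_mem_tile hy
    exact ⟨mem_univ _, h1.trans (hy'.1.le.trans (le_max_left _ _)),
      h2.trans (hy'.2.le.trans (le_max_right _ _))⟩

/-- Distinct unit triangles meet at corners only. -/
lemma mem_range_corner_of_τ_eq {i j : Label} (hij : i ≠ j) {x y : Plane} (hx : x ∈ gasket)
    (hy : y ∈ gasket) (h : τ i x = τ j y) : x ∈ range corner := by
  obtain ⟨s, v, hv⟩ := i
  obtain ⟨t, v', hv'⟩ := j
  have hx' := gasket_subset_solidTriangle hx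
  have hy' := gasket_subset_solidTriangle hy
  obtain ⟨a, b, hab⟩ := exists_nat_coord_of_mem_unitCorners hv
  obtain ⟨a', b', hab'⟩ := exists_nat_coord_of_mem_unitCorners hv'
  have same : s = t → x + v = y + v' → x ∈ range corner := by
    intro hst hxy
    refine mem_range_corner_of_add_lattice hx' hy' (a := a - a') (b := b - b') (fun h0 => ?_) ?_
    · rw [Prod.mk_eq_zero, sub_eq_zero, sub_eq_zero] at h0
      have : v = v' := by
        apply coord_injective
        rw [hab, hab']
        have h1 : (a : ℝ) = a' := by exact_mod_cast h0.1
        have h2 : (b : ℝ) = b' := by exact_mod_cast h0.2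
        rw [h1, h2]
      subst this hst
      exact hij rfl
    · have := congrArg coord hxy
      rw [coord_add, coord_add, hab, hab'] at this
      rw [eq_comm, ← sub_eq_iff_eq_add] at this
      rw [← this]
      ext <;> simp
  -- In opposite halves, nonnegative coordinates sum to zero, so the tiles can meet only at the
  -- origin.
  have opposite : ∀ z : Plane, z ∈ solidTriangle → ∀ u, u ∈ unitCorners →
      x + v = -(z + u) → x ∈ range corner := by
    intro z hz u hu hzu
    obtain ⟨c, d, hcd⟩ := exists_nat_coord_of_mem_unitCorners hu
    refine ⟨0, coord_injective ?_⟩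
    have h0 := congrArg coord hzu
    rw [coord_add, coord_neg, coord_add, hab, hcd] at h0
    have h1 := congrArg Prod.fst h0
    have h2 := congrArg Prod.snd h0
    simp only [Prod.fst_add, Prod.snd_add, Prod.fst_neg, Prod.snd_neg] at h1 h2
    obtain ⟨k1, k2, -⟩ := hx'
    obtain ⟨l1, l2, -⟩ := hz
    have := Nat.cast_nonneg (α := ℝ) a
    have := Nat.cast_nonneg (α := ℝ) b
    have := Nat.cast_nonneg (α := ℝ) c
    have := Nat.cast_nonneg (α := ℝ) d
    rw [coord_corner_zero]
    ext <;> simp only <;> linarith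
  cases s <;> cases t
  · exact same rfl (neg_injective (by simpa [τ] using h))
  · refine opposite y hy' v' hv' ?_
    have h' : -(x + v) = y + v' := by simpa [τ] using h
    rw [← h', neg_neg]
  · exact opposite y hy' v' hv' (by simpa [τ] using h)
  · exact same rfl (by simpa [τ] using h)

lemma τ_mem_VHat (i : Label) {x : Plane} {m : ℕ} (hx : x ∈ V m) : τ i x ∈ VHat m := by
  obtain ⟨s, v, w, rfl⟩ := i
  refine mem_iUnion.2 ⟨w.length, ?_⟩
  have h := FWord_mem_V w hx
  cases s
  · refine ⟨-FWord w x, Or.inr (by simpa using h), ?_⟩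
    simp [τ, two_pow_smul_FWord w x]
  · refine ⟨FWord w x, Or.inl h, ?_⟩
    simp [τ, two_pow_smul_FWord w x]

lemma tile_subset_infGasket (i : Label) : tile i ⊆ infGasket := by
  refine (image_closure_subset_closure_image (isometry_τ i).continuous).trans (closure_mono ?_)
  rintro _ ⟨x, hx, rfl⟩
  obtain ⟨m, hm⟩ := mem_iUnion.1 hx
  exact mem_iUnion.2 ⟨m, τ_mem_VHat i hm⟩

/-- Every point of a dyadic triangle of side length at least `1` lies in a unit triangle contained
in it. -/
lemma exists_tile_subset_triangle (i : Label) (m : ℕ) {x : Plane} (hx : x ∈ triangle i m) :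
    ∃ j, x ∈ tile j ∧ tile j ⊆ triangle i m := by
  obtain ⟨s, v, hv⟩ := i
  obtain ⟨_, ⟨y, hy, rfl⟩, rfl⟩ := hx
  obtain ⟨v', hv', ⟨z, hz, h1⟩, h2⟩ := exists_two_pow_smul_add hv m hy
  refine ⟨(s, ⟨v', hv'⟩), ⟨z, hz, ?_⟩, ?_⟩
  · cases s <;> simp [τ, ← h1, -smul_add, -neg_add_rev]
  · rintro _ ⟨t, ht, rfl⟩
    obtain ⟨t', ht', h⟩ := h2 t ht
    refine ⟨_, ⟨t', ht', rfl⟩, ?_⟩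
    cases s <;> simp [τ, h, -smul_add, -neg_add_rev]

/-- A dyadic triangle of side length `2⁻ᵐ` is a cell of level `m` of a unit triangle. -/
lemma exists_smul_τ_eq (i : Label) (m : ℕ) :
    ∃ j, ∃ w : Fin m → Fin 3, ∀ x, ((2 : ℝ) ^ (-(m : ℤ))) • τ i x = τ j (FWord (List.ofFn w) x) := by
  obtain ⟨s, v, hv⟩ := i
  obtain ⟨v', hv', w, hw⟩ := exists_inv_two_pow_smul_add hv m
  refine ⟨(s, ⟨v', hv'⟩), w, fun x => ?_⟩
  cases s <;> simp [τ, ← hw, -smul_add, -neg_add_rev]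

lemma FWord_mem_gasket (w : List (Fin 3)) {x : Plane} (hx : x ∈ gasket) : FWord w x ∈ gasket := by
  induction w with
  | nil => exact hx
  | cons i w ih => exact F_mem_gasket ih i

lemma exists_triangle_subset_tile (i : Label) (m : ℕ) : ∃ j, triangle i (-m) ⊆ tile j := by
  obtain ⟨j, w, h⟩ := exists_smul_τ_eq i m
  refine ⟨j, ?_⟩
  rintro _ ⟨_, ⟨x, hx, rfl⟩, rfl⟩
  exact ⟨_, FWord_mem_gasket _ hx, (h x).symm⟩

/-- Local finiteness makes the union closed, so it is enough to place vertices; each lies in a large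
triangle at the origin, which splits into tiles. -/
lemma infGasket_eq_iUnion_tile : infGasket = ⋃ i, tile i := by
  refine Subset.antisymm (closure_minimal (iUnion_subset fun m => iUnion_subset fun k => ?_)
    (locallyFinite_tile.isClosed_iUnion fun i => (isCompact_tile i).isClosed))
    (iUnion_subset tile_subset_infGasket)
  have mem : ∀ x ∈ V (m + k), x ∈ gasket := fun x hx => subset_closure (mem_iUnion.2 ⟨_, hx⟩)
  rintro _ ⟨x, hx, rfl⟩
  have : ∃ i : Label, (2 : ℝ) ^ k • x ∈ triangle i k := by
    rcases hx with hx | hx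
    · refine ⟨(true, ⟨0, zero_mem_unitCorners⟩), x, ⟨x, mem x hx, by simp [τ]⟩, by simp⟩
    · refine ⟨(false, ⟨0, zero_mem_unitCorners⟩), x, ⟨-x, mem _ hx, by simp [τ]⟩, by simp⟩
  obtain ⟨i, hi⟩ := this
  obtain ⟨j, hj, -⟩ := exists_tile_subset_triangle i k hi
  exact mem_iUnion.2 ⟨j, hj⟩

lemma triangle_subset_infGasket (i : Label) (m : ℤ) : triangle i m ⊆ infGasket := by
  obtain ⟨n, rfl | rfl⟩ := m.eq_nat_or_neg
  · intro x hx
    obtain ⟨j, hj, -⟩ := exists_tile_subset_triangle i n hx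
    exact tile_subset_infGasket j hj
  · obtain ⟨j, hj⟩ := exists_triangle_subset_tile i n
    exact hj.trans (tile_subset_infGasket j)

lemma isCompact_triangle (i : Label) (m : ℤ) : IsCompact (triangle i m) :=
  (isCompact_tile i).smul _

lemma diam_preimage_triangle (i : Label) (m : ℤ) :
    Metric.diam ((Subtype.val : infGasket → Plane) ⁻¹' triangle i m) = (2 : ℝ) ^ m := by
  rw [← isometry_subtype_coe.diam_image, Subtype.image_preimage_coe,
    inter_eq_right.2 (triangle_subset_infGasket i m), triangle, diam_smul₀,
    (isometry_τ i).diam_image, diam_gasket, mul_one, norm_zpow, Real.norm_ofNat]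

/-! ### Neighbours of a unit triangle -/

/-- The labels of the unit triangles that share a corner with `tile i`. -/
def neighbours (i : Label) : Set Label :=
  {j | ∃ k l, τ j (corner k) = τ i (corner l)}

/-- A sum over the at most `18` neighbours of a unit triangle. -/
lemma tsum_le_of_support_subset_neighbours (i : Label) {f : Label → ℝ≥0∞} {c : ℝ≥0∞}
    (hf : ∀ j, f j ≤ c) (hs : ∀ j, j ∉ neighbours i → f j = 0) : ∑' j, f j ≤ 18 * c := by
  have hs' : Function.support f ⊆ neighbours i := fun j hj => by
    by_contra h
    exact hj (hs j h)
  choose k hk using fun j : neighbours i => j.2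
  choose l hl using hk
  -- The orientation and the pair of matched corners determine the translation, hence the label;
  -- there are `2 * 3 * 3 = 18` such triples.
  have inj : Function.Injective fun j : neighbours i => (j.1.1, k j, l j) := by
    rintro ⟨⟨s, v⟩, hj⟩ ⟨⟨t, v'⟩, hj'⟩ h
    simp only [Prod.mk.injEq] at h
    obtain ⟨rfl, h1, h2⟩ := h
    have e := (hl ⟨(s, v), hj⟩).trans ((congrArg (fun z => τ i (corner z)) h2).trans
      (hl ⟨(s, v'), hj'⟩).symm)
    rw [h1] at e
    have : v = v' := by
      apply Subtype.ext
      cases s <;> simpa [τ] using e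
    subst this
    rfl
  calc ∑' j, f j = ∑' j : neighbours i, f j := (tsum_subtype_eq_of_support_subset hs').symm
    _ ≤ ∑' _ : neighbours i, c := ENNReal.tsum_le_tsum fun j => hf j
    _ ≤ ∑' _ : Bool × Fin 3 × Fin 3, c := ENNReal.tsum_comp_le_tsum_of_injective inj fun _ => c
    _ = 18 * c := by
      rw [tsum_fintype]
      simp

/-! ### Piecewise harmonic functions on the infinite gasket -/

lemma exists_address (x : infGasket) : ∃ z : Label × (ℕ → Fin 3), τ z.1 (address z.2) = x := by
  obtain ⟨i, hi⟩ := mem_iUnion.1 (infGasket_eq_iUnion_tile.subset x.2)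
  obtain ⟨ω, h⟩ := exists_address_of_mem_tile hi
  exact ⟨(i, ω), h⟩

/-- The values of `f` at the three corners of a unit triangle. -/
noncomputable def cornerValues (f : Plane → ℝ) (i : Label) (k : Fin 3) : ℝ := f (τ i (corner k))

/-- The function on the infinite gasket that is harmonic on the unit triangles and agrees with `f`
at their corners. -/
noncomputable def harmonicExtension (f : Plane → ℝ) (x : infGasket) : ℝ :=
  harmonic (cornerValues f (exists_address x).choose.1) (exists_address x).choose.2

lemma harmonic_cornerValues_eq (f : Plane → ℝ) {i j : Label} {ω η : ℕ → Fin 3}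
    (h : τ i (address ω) = τ j (address η)) :
    harmonic (cornerValues f i) ω = harmonic (cornerValues f j) η := by
  by_cases hij : i = j
  · subst hij
    exact harmonic_eq_of_address_eq ((isometry_τ i).injective h) _
  · obtain ⟨k, hk⟩ :=
      mem_range_corner_of_τ_eq hij (address_mem_gasket ω) (address_mem_gasket η) h
    obtain ⟨l, hl⟩ :=
      mem_range_corner_of_τ_eq (Ne.symm hij) (address_mem_gasket η) (address_mem_gasket ω) h.symm
    rw [← hk, ← hl] at h
    rw [eq_const_of_address_eq_corner hk.symm, eq_const_of_address_eq_corner hl.symm,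
      harmonic_const_address, harmonic_const_address, cornerValues, cornerValues, h]

lemma harmonicExtension_eq (f : Plane → ℝ) {x : infGasket} {i : Label} {ω : ℕ → Fin 3}
    (h : τ i (address ω) = x) : harmonicExtension f x = harmonic (cornerValues f i) ω :=
  harmonic_cornerValues_eq f ((exists_address x).choose_spec.trans h.symm)

/-- A continuous map from a compact space to a Hausdorff space is a quotient map onto its image.
This transfers continuity from addresses to tiles. -/
lemma continuousOn_range_of_comp {X Y Z : Type*} [TopologicalSpace X] [CompactSpace X]
    [TopologicalSpace Y] [T2Space Y] [TopologicalSpace Z] {φ : X → Y} (hφ : Continuous φ)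
    {u : Y → Z} (hu : Continuous (u ∘ φ)) : ContinuousOn u (range φ) := by
  have hq : IsQuotientMap (rangeFactorization φ) :=
    (hφ.subtype_mk _).isClosedMap.isQuotientMap (hφ.subtype_mk _)
      rangeFactorization_surjective
  exact continuousOn_iff_continuous_domRestrict.2 (hq.continuous_iff.2 hu)

lemma continuous_harmonicExtension (f : Plane → ℝ) : Continuous (harmonicExtension f) := by
  have hr : ∀ i, (Subtype.val : infGasket → Plane) ⁻¹' tile i =
      range fun ω => (⟨τ i (address ω), tile_subset_infGasket i (mem_tile_address i ω)⟩ :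
        infGasket) := by
    intro i
    ext x
    constructor
    · intro hx
      obtain ⟨ω, h⟩ := exists_address_of_mem_tile hx
      exact ⟨ω, Subtype.ext h⟩
    · rintro ⟨ω, rfl⟩
      exact mem_tile_address i ω
  refine (locallyFinite_tile.preimage_continuous continuous_subtype_val).continuous ?_
    (fun i => (isCompact_tile i).isClosed.preimage continuous_subtype_val) fun i => ?_
  · rw [← preimage_iUnion, ← infGasket_eq_iUnion_tile, Subtype.coe_preimage_self]
  · rw [hr]
    refine continuousOn_range_of_comp
      (((isometry_τ i).continuous.comp continuous_address).subtype_mk _) ?_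
    refine (continuous_harmonic (cornerValues f i)).congr fun ω => ?_
    exact (harmonicExtension_eq f rfl).symm

lemma harmonicExtension_FWord_corner (f : Plane → ℝ) {x : infGasket} {i : Label}
    {w : List (Fin 3)} {k : Fin 3} (h : τ i (FWord w (corner k)) = x) :
    harmonicExtension f x = w.foldl (fun b i => harmonicStep i b) (cornerValues f i) k := by
  rw [← address_const, FWord_address] at h
  rw [harmonicExtension_eq f h, harmonic_foldr_cons, harmonic_const_address]

lemma exists_cell_of_adj {m : ℕ} {x y : Plane} (h : Adj m x y) :
    ∃ z : (Label × (Fin m → Fin 3)) × Fin 3 × Fin 3,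
      τ z.1.1 (FWord (List.ofFn z.1.2) (corner z.2.1)) = x ∧
        τ z.1.1 (FWord (List.ofFn z.1.2) (corner z.2.2)) = y := by
  obtain ⟨-, -, -, i, ⟨_, ⟨_, ⟨k, rfl⟩, rfl⟩, rfl⟩, ⟨_, ⟨_, ⟨l, rfl⟩, rfl⟩, rfl⟩⟩ := h
  obtain ⟨j, w, hw⟩ := exists_smul_τ_eq i m
  exact ⟨((j, w), k, l), (hw _).symm, (hw _).symm⟩

/-- Neighbouring pairs inject into pairs of corners of level-`m` cells, and the sum over the cells
of one tile is its corner energy by `sum_cornerEnergy_foldl`. -/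
lemma discreteEnergy_harmonicExtension_le (f : Plane → ℝ) (m : ℕ) :
    discreteEnergy m (harmonicExtension f) ≤
      ∑' i, ENNReal.ofReal (cornerEnergy (cornerValues f i)) := by
  let D : Label → (Fin m → Fin 3) → Fin 3 → ℝ := fun i w =>
    (List.ofFn w).foldl (fun b i => harmonicStep i b) (cornerValues f i)
  let g : (Label × (Fin m → Fin 3)) × Fin 3 × Fin 3 → ℝ≥0∞ := fun z =>
    ENNReal.ofReal (2⁻¹ * (5 / 3) ^ m * (D z.1.1 z.1.2 z.2.1 - D z.1.1 z.1.2 z.2.2) ^ 2)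
  choose z hz using fun e : {e : infGasket × infGasket // Adj m e.1 e.2} => exists_cell_of_adj e.2
  have inj : Function.Injective z := by
    intro e e' h
    have h1 := hz e
    have h2 := hz e'
    rw [← h] at h2
    exact Subtype.ext (Prod.ext (Subtype.ext (h1.1.symm.trans h2.1))
      (Subtype.ext (h1.2.symm.trans h2.2)))
  calc discreteEnergy m (harmonicExtension f) = ∑' e, g (z e) := by
        refine tsum_congr fun e => ?_
        rw [harmonicExtension_FWord_corner f (hz e).1, harmonicExtension_FWord_corner f (hz e).2]
    _ ≤ ∑' z, g z := ENNReal.tsum_comp_le_tsum_of_injective inj g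
    _ = ∑' i, ENNReal.ofReal (cornerEnergy (cornerValues f i)) := by
        rw [ENNReal.tsum_prod', ENNReal.tsum_prod']
        refine tsum_congr fun i => ?_
        rw [tsum_fintype]
        simp only [tsum_fintype, Fintype.sum_prod_type, g]
        have nn : ∀ w j k, 0 ≤ 2⁻¹ * (5 / 3 : ℝ) ^ m * (D i w j - D i w k) ^ 2 :=
          fun w j k => by positivity
        simp_rw [← ENNReal.ofReal_sum_of_nonneg fun k _ => nn _ _ k]
        simp_rw [← ENNReal.ofReal_sum_of_nonneg fun j _ =>
          Finset.sum_nonneg fun k _ => nn _ j k]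
        rw [← ENNReal.ofReal_sum_of_nonneg fun w _ =>
          Finset.sum_nonneg fun j _ => Finset.sum_nonneg fun k _ => nn w j k]
        congr 1
        calc ∑ w, ∑ j, ∑ k, 2⁻¹ * (5 / 3 : ℝ) ^ m * (D i w j - D i w k) ^ 2
            = (5 / 3 : ℝ) ^ m * ∑ w, cornerEnergy (D i w) := by
              simp only [cornerEnergy, Finset.mul_sum]
              refine Finset.sum_congr rfl fun w _ => Finset.sum_congr rfl fun j _ =>
                Finset.sum_congr rfl fun k _ => by ring
          _ = cornerEnergy (cornerValues f i) := by
              rw [sum_cornerEnergy_foldl, ← mul_assoc, ← mul_pow]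
              norm_num

lemma energy_harmonicExtension_le (f : Plane → ℝ) :
    energy (harmonicExtension f) ≤ ∑' i, ENNReal.ofReal (cornerEnergy (cornerValues f i)) :=
  (liminf_le_liminf (Eventually.of_forall (discreteEnergy_harmonicExtension_le f))).trans_eq
    (by simp)

/-! ### The Hausdorff measure -/

lemma gasketMeasure_apply {s : Set Plane} (hs : MeasurableSet s) :
    gasketMeasure s = Measure.infinitePi
      (fun _ : ℕ => (PMF.uniformOfFintype (Fin 3)).toMeasure) (address ⁻¹' s) :=
  Measure.map_apply continuous_address.measurable hs

instance : IsProbabilityMeasure gasketMeasure :=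
  Measure.isProbabilityMeasure_map continuous_address.measurable.aemeasurable

lemma gasketMeasure_eq_one {s : Set Plane} (h : gasket ⊆ s) : gasketMeasure s = 1 := by
  refine le_antisymm prob_le_one ?_
  calc 1 = gasketMeasure gasket := by
        rw [gasketMeasure_apply isCompact_gasket.isClosed.measurableSet,
          preimage_eq_univ_iff.2 gasket_eq_range_address.ge, measure_univ]
    _ ≤ gasketMeasure s := measure_mono h

lemma measurableEmbedding_val : MeasurableEmbedding (Subtype.val : infGasket → Plane) :=
  MeasurableEmbedding.subtype_coe isClosed_closure.measurableSet

lemma νHat_apply {s : Set infGasket} (hs : MeasurableSet s) :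
    νHat s = ∑' i, gasketMeasure (τ i ⁻¹' (Subtype.val '' s)) := by
  have hs' := measurableEmbedding_val.measurableSet_image' hs
  rw [νHat, measurableEmbedding_val.comap_apply, Measure.sum_apply _ hs']
  exact tsum_congr fun i => Measure.map_apply (isometry_τ i).continuous.measurable hs'

/-! ### Test functions -/

/-- The piecewise harmonic function with value `1` at the corners of `tile i`, and `0` at all other
corners of unit triangles. -/
noncomputable def bump (i : Label) : C(infGasket, ℝ) where
  toFun := harmonicExtension ((τ i '' range corner).indicator fun _ => 1)
  continuous_toFun := continuous_harmonicExtension _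

lemma cornerValues_indicator_mem_Icc (i j : Label) (k : Fin 3) :
    cornerValues ((τ i '' range corner).indicator fun _ => 1) j k ∈ Icc (0 : ℝ) 1 := by
  unfold cornerValues indicator
  split_ifs <;> simp

lemma cornerValues_indicator_self (i : Label) :
    cornerValues ((τ i '' range corner).indicator fun _ => 1) i = fun _ => 1 := by
  funext k
  exact indicator_of_mem (mem_image_of_mem _ (mem_range_self k)) _

lemma cornerValues_indicator_of_notMem {i j : Label} (h : j ∉ neighbours i) :
    cornerValues ((τ i '' range corner).indicator fun _ => 1) j = fun _ => 0 := by
  funext k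
  refine indicator_of_notMem ?_ _
  rintro ⟨_, ⟨l, rfl⟩, hl⟩
  exact h ⟨k, l, hl.symm⟩

lemma bump_eq_one {i : Label} {x : infGasket} (hx : (x : Plane) ∈ tile i) : bump i x = 1 := by
  obtain ⟨ω, h⟩ := exists_address_of_mem_tile hx
  exact (harmonicExtension_eq _ h).trans
    (by rw [cornerValues_indicator_self, harmonic_const])

lemma bump_eq_zero {i j : Label} (hj : j ∉ neighbours i) {x : infGasket}
    (hx : (x : Plane) ∈ tile j) : bump i x = 0 := by
  obtain ⟨ω, h⟩ := exists_address_of_mem_tile hx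
  exact (harmonicExtension_eq _ h).trans
    (by rw [cornerValues_indicator_of_notMem hj, harmonic_const])

lemma bump_mem_Icc (i : Label) (x : infGasket) : bump i x ∈ Icc (0 : ℝ) 1 :=
  harmonic_mem_Icc (cornerValues_indicator_mem_Icc i _) _

lemma cornerEnergy_le {a : Fin 3 → ℝ} (ha : ∀ k, a k ∈ Icc (0 : ℝ) 1) : cornerEnergy a ≤ 5 := by
  have h : ∀ j k, 2⁻¹ * (a j - a k) ^ 2 ≤ 2⁻¹ := fun j k => by
    have : (a j - a k) ^ 2 ≤ 1 := by
      rw [sq_le_one_iff_abs_le_one, abs_le]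
      constructor <;> linarith [(ha j).1, (ha j).2, (ha k).1, (ha k).2]
    linarith
  calc cornerEnergy a ≤ ∑ _j : Fin 3, ∑ _k : Fin 3, 2⁻¹ :=
        Finset.sum_le_sum fun j _ => Finset.sum_le_sum fun k _ => h j k
    -- Nine terms of at most 1/2 give 9/2, rounded up.
    _ ≤ 5 := by norm_num

lemma energy_bump_le (i : Label) : energy (bump i) ≤ 18 * 5 := by
  refine (energy_harmonicExtension_le _).trans
    (tsum_le_of_support_subset_neighbours i (fun j => ?_) fun j hj => ?_)
  · exact ENNReal.ofReal_le_of_le_toReal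
      ((cornerEnergy_le (cornerValues_indicator_mem_Icc i j)).trans_eq (by simp))
  · simp [cornerValues_indicator_of_notMem hj, cornerEnergy]

lemma νHat_support_bump_le (i : Label) : νHat (Function.support (bump i)) ≤ 18 := by
  have hm : MeasurableSet (Function.support (bump i)) :=
    (isOpen_ne_fun (bump i).continuous continuous_const).measurableSet
  rw [νHat_apply hm]
  refine (tsum_le_of_support_subset_neighbours i (fun _ => prob_le_one) fun j hj => ?_).trans_eq
    (mul_one _)
  rw [gasketMeasure_apply ((isometry_τ j).continuous.measurable
    (measurableEmbedding_val.measurableSet_image' hm))]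
  refine (congrArg _ ?_).trans measure_empty
  refine eq_empty_of_forall_notMem ?_
  rintro ω ⟨x, hx, h⟩
  exact hx (bump_eq_zero hj (h ▸ mem_tile_address j ω))

lemma eLpNorm_bump_le (i : Label) (p : ℝ≥0∞) :
    eLpNorm (bump i) p νHat ≤ 18 ^ (1 / p.toReal) := by
  calc eLpNorm (bump i) p νHat
      ≤ eLpNorm ((Function.support (bump i)).indicator fun _ => (1 : ℝ)) p νHat := by
        refine eLpNorm_mono fun x => ?_
        by_cases hx : bump i x = 0
        · rw [hx, norm_zero]
          exact norm_nonneg _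
        · rw [indicator_of_mem hx, norm_one, Real.norm_of_nonneg (bump_mem_Icc i x).1]
          exact (bump_mem_Icc i x).2
    _ ≤ ‖(1 : ℝ)‖ₑ * νHat (Function.support (bump i)) ^ (1 / p.toReal) :=
        eLpNorm_indicator_const_le _ _
    _ ≤ 18 ^ (1 / p.toReal) := by
        rw [enorm_one, one_mul]
        exact ENNReal.rpow_le_rpow (νHat_support_bump_le i) (by positivity)

lemma bump_mem_dirichletDomain (i : Label) : bump i ∈ dirichletDomain := by
  refine ⟨(energy_bump_le i).trans_lt (by finiteness), ?_⟩
  exact ⟨(bump i).continuous.aestronglyMeasurable, (eLpNorm_bump_le i 2).trans_lt (by finiteness)⟩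

/-! ### Measure bounds on unit and larger triangles -/

/-- A Sobolev inequality bounds the measure of all unit triangles. -/
lemma SobolevInequality.exists_measure_tile_le {σ : Measure infGasket} {p q : ℝ} (hq : 0 < q)
    {N : ℕ} {b : Fin N → ℝ} (hb : ∀ i, b i ∈ Icc (0 : ℝ) 1) {C : ℝ}
    (hsob : SobolevInequality σ p q b C) :
    ∃ K : ℝ, 1 ≤ K ∧ ∀ i, σ (Subtype.val ⁻¹' tile i) ≤ ENNReal.ofReal K := by
  -- The right-hand side of the inequality for `bump i`, with energy and norm replaced by bounds
  -- that do not depend on `i`, raised to the power `q`.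
  set B : ℝ≥0∞ := (ENNReal.ofReal C * ∑ k, (18 * 5) ^ (b k / 2) *
    ((18 : ℝ≥0∞) ^ (1 / (ENNReal.ofReal p).toReal)) ^ (1 - b k)) ^ q with hB
  have hBtop : B ≠ ∞ := by
    refine ENNReal.rpow_ne_top_of_nonneg hq.le (ENNReal.mul_ne_top ENNReal.ofReal_ne_top ?_)
    refine ENNReal.sum_ne_top.2 fun k _ => ENNReal.mul_ne_top ?_ ?_
    · exact ENNReal.rpow_ne_top_of_nonneg (by linarith [(hb k).1]) (by finiteness)
    · exact ENNReal.rpow_ne_top_of_nonneg (by linarith [(hb k).2])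
        (ENNReal.rpow_ne_top_of_nonneg (by positivity) (by finiteness))
  refine ⟨max 1 B.toReal, le_max_left _ _, fun i => ?_⟩
  have hq0 : ENNReal.ofReal q ≠ 0 := (ENNReal.ofReal_pos.2 hq).ne'
  calc σ (Subtype.val ⁻¹' tile i) ≤ σ {x | 1 ≤ ‖bump i x‖ₑ} :=
        measure_mono fun x hx => by simp [bump_eq_one (i := i) hx]
    _ ≤ 1⁻¹ ^ (ENNReal.ofReal q).toReal *
          eLpNorm (bump i) (ENNReal.ofReal q) σ ^ (ENNReal.ofReal q).toReal :=
        meas_ge_le_mul_pow_eLpNorm_enorm σ hq0 ENNReal.ofReal_ne_top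
          (bump i).continuous.aestronglyMeasurable one_ne_zero (by simp)
    _ = eLpNorm (bump i) (ENNReal.ofReal q) σ ^ q := by
        rw [inv_one, ENNReal.one_rpow, one_mul, ENNReal.toReal_ofReal hq.le]
    _ ≤ B := by
        refine ENNReal.rpow_le_rpow ((hsob _ (bump_mem_dirichletDomain i)).trans ?_) hq.le
        gcongr with k
        · linarith [(hb k).1]
        · exact energy_bump_le i
        · linarith [(hb k).2]
        · exact eLpNorm_bump_le i _
    _ = ENNReal.ofReal B.toReal := (ENNReal.ofReal_toReal hBtop).symm
    _ ≤ ENNReal.ofReal (max 1 B.toReal) := ENNReal.ofReal_le_ofReal (le_max_right _ _)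

/-- A uniform bound on unit triangles gives a linear bound on all larger triangles. -/
lemma measure_triangle_le {σ : Measure infGasket} {K : ℝ≥0∞}
    (hK : ∀ i, σ (Subtype.val ⁻¹' tile i) ≤ K) (i : Label) (m : ℕ) :
    σ (Subtype.val ⁻¹' triangle i m) ≤ K * νHat (Subtype.val ⁻¹' triangle i m) := by
  set J : Set Label := {j | tile j ⊆ triangle i m} with hJ
  calc σ (Subtype.val ⁻¹' triangle i m)
      ≤ σ (⋃ j : J, Subtype.val ⁻¹' tile (j : Label)) := by
        refine measure_mono fun x hx => ?_
        obtain ⟨j, hj, hji⟩ := exists_tile_subset_triangle i m hx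
        exact mem_iUnion.2 ⟨⟨j, hji⟩, hj⟩
    _ ≤ ∑' j : J, σ (Subtype.val ⁻¹' tile (j : Label)) := measure_iUnion_le _
    -- The factor 1 is kept so that it can be read as the mass of the copy of `gasketMeasure` on
    -- tile `j`.
    _ ≤ ∑' _ : J, K * 1 := ENNReal.tsum_le_tsum fun j => by
        rw [mul_one]
        exact hK j
    _ = K * ∑' j : J, gasketMeasure (τ (j : Label) ⁻¹' triangle i m) := by
        rw [ENNReal.tsum_mul_left]
        refine congrArg _ (tsum_congr fun j => (gasketMeasure_eq_one ?_).symm)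
        exact image_subset_iff.1 j.2
    _ ≤ K * ∑' j, gasketMeasure (τ j ⁻¹' triangle i m) := by
        gcongr
        exact ENNReal.tsum_comp_le_tsum_of_injective Subtype.val_injective _
    _ = K * νHat (Subtype.val ⁻¹' triangle i m) := by
        rw [νHat_apply ((isCompact_triangle i m).isClosed.measurableSet.preimage
          measurable_subtype_coe), Subtype.image_preimage_coe,
          inter_eq_right.2 (triangle_subset_infGasket i m)]

end SierpinskiGasket

/-- Necessity of the two-scale upper regularity condition for Sobolev inequalities. -/
theorem mainTheorem4 (σ : MeasureTheory.Measure SierpinskiGasket.infGasket)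
    (p q : ℝ) (hp : 0 < p) (hq : 0 < q)
    (N : ℕ) (hN : 0 < N) (b : Fin N → ℝ) (hb : ∀ i, b i ∈ Set.Icc (0 : ℝ) 1)
    (C : ℝ) (hC : 0 < C)
    (hsob : SierpinskiGasket.SobolevInequality σ p q b C) :
    ∃ δlo δhi : ℝ≥0∞, 0 < δlo ∧ δlo ≤ δhi ∧ 1 ≤ δhi ∧
      ∃ C' : ℝ, 1 ≤ C' ∧ SierpinskiGasket.UpperRegular σ C' δlo δhi := by
  obtain ⟨K, hK1, hK⟩ := hsob.exists_measure_tile_le hq hb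
  -- With `δhi = ∞` the power of `νHat S` is 1, leaving the bound `K`; with `δlo = 1` the bound is
  -- linear.
  refine ⟨1, ∞, one_pos, le_top, le_top, K, hK1, ?_⟩
  rintro _ ⟨i, m, rfl⟩
  rw [SierpinskiGasket.diam_preimage_triangle]
  refine ⟨fun _ hm => ?_, fun hm => ?_⟩
  · have hm' : m < 0 := by
      by_contra! h
      exact absurd (one_le_zpow₀ one_le_two h) (not_le.2 hm)
    lift -m to ℕ using by omega with n hn
    obtain rfl : m = -n := by omega
    obtain ⟨j, hj⟩ := SierpinskiGasket.exists_triangle_subset_tile i n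
    simpa using (MeasureTheory.measure_mono (Set.preimage_mono hj)).trans (hK j)
  · have hm' : 0 ≤ m := by
      by_contra! h
      exact absurd (zpow_lt_one_of_neg₀ one_lt_two h) (not_lt.2 hm)
    lift m to ℕ using hm'
    simpa using SierpinskiGasket.measure_triangle_le hK i m
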